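/- A simple game on $N=\{1,\dots,n\}$ is a family $\mathcal W$ of subsets of $N$ (the winning coalitions; all other subsets are losing) with $\emptyset\notin\mathcal W$, $N\in\mathcal W$, and such that $S\in\mathcal W$, $S\subseteq T\subseteq N$ imply $T\in\mathcal W$. It is weighted if there are real weights $w_1,\dots,w_n\ge 0$ and a quota $q>0$ such that $S\in\mathcal W$ if and only if $\sum_{i\in S}w_i\ge q$. Write $i\succsim j$ if exchanging the players $i$ and $j$ turns every winning coalition containing $j$ into a winning coalition (containing $i$), and $i\approx j$ if $i\succsim j$ and $j\succsim i$. In a weighted game $\succsim$ is total, so it orders the $\approx$-classes linearly, $N_1>N_2>\dots>N_t$. A vector $(m_1,\dots,m_t)$ of integers with $0\le m_h\le |N_h|$ is winning (losing) if the coalitions with exactly $m_h$ members in $N_h$ for each $h$ are winning (losing). For vectors write $a\succeq b$ if $\sum_{h=1}^k a_h\ge\sum_{h=1}^k b_h$ for all $1\le k\le t$. A losing vector $m$ is shift-maximal losing if every vector $m'\ne m$ with $m'\succeq m$ is winning. Two simple games on $N$ are isomorphic if a permutation of $N$ carries the winning coalitions of one exactly onto those of the other. Let $\overline{wg}(n,\ast,1)$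 be the number, up to isomorphism, of weighted games with $n$ players that have exactly one shift-maximal losing vector (with any number $t$ of classes). Then $$\overline{wg}(n,\ast,1)=\begin{cases}2^n-1 & \text{if } n\le 5,\\[4pt] \dfrac{n^4-6n^3+23n^2-18n+12}{12} & \text{if } n\ge 6.\end{cases}$$ -/

import Mathlib

/-- A (monotonic) simple game on the finite player set `N`, given by its winning coalitions. -/
@[ext]
structure SimpleGame (N : Type*) [Fintype N] where
  /-- the collection of winning coalitions -/
  W : Set (Finset N)
  empty_notMem : ∅ ∉ W
  univ_mem : Finset.univ ∈ W
  mono : ∀ ⦃S T : Finset N⦄, S ∈ W → S ⊆ T → T ∈ W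

namespace SimpleGame

/-- Isomorphism of simple games: a bijection of the player sets that preserves and reflects
winning coalitions. -/
def Iso {N N' : Type*} [Fintype N] [Fintype N'] (G : SimpleGame N) (G' : SimpleGame N') : Prop :=
  ∃ f : N ≃ N', ∀ S : Finset N, S ∈ G.W ↔ S.map f.toEmbedding ∈ G'.W

/-- Being isomorphic, as an equivalence relation on the simple games on `N`. -/
def isoSetoid (N : Type*) [Fintype N] : Setoid (SimpleGame N) where
  r G G' := G.Iso G'
  iseqv :=
    { refl := fun G => ⟨Equiv.refl N, fun S => by simp⟩
      symm := by
        rintro G G' ⟨f, hf⟩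
        refine ⟨f.symm, fun S => ?_⟩
        rw [hf (S.map f.symm.toEmbedding), Finset.map_map]
        simp
      trans := by
        rintro G G' G'' ⟨f, hf⟩ ⟨g, hg⟩
        refine ⟨f.trans g, fun S => ?_⟩
        rw [hf S, hg, Finset.map_map]
        simp [Equiv.trans_toEmbedding] }

/-- The game is weighted: it has a representation `[q; w]` by non-negative real weights and a
positive real quota. -/
def IsWeighted {N : Type*} [Fintype N] (G : SimpleGame N) : Prop :=
  ∃ (w : N → ℝ) (q : ℝ), (∀ i, 0 ≤ w i) ∧ 0 < q ∧ ∀ S : Finset N, S ∈ G.W ↔ q ≤ ∑ i ∈ S, w i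

theorem map_swap_of_notMem {N : Type*} [DecidableEq N] {i j : N} {S : Finset N} (hi : i ∉ S) (hj : j ∈ S) :
    S.map (Equiv.swap i j).toEmbedding = insert i (S.erase j) := by
  ext x
  simp only [Finset.mem_map_equiv, Equiv.symm_swap, Finset.mem_insert, Finset.mem_erase]
  by_cases h1 : x = i
  · subst h1; simp [hj]
  · by_cases h2 : x = j
    · subst h2; simp [h1, hi]
    · simp [Equiv.swap_apply_of_ne_of_ne h1 h2, h1, h2]

theorem map_swap_of_mem {N : Type*} [DecidableEq N] {i j : N} {S : Finset N} (hi : i ∈ S) (hj : j ∈ S) :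
    S.map (Equiv.swap i j).toEmbedding = S := by
  ext x
  simp only [Finset.mem_map_equiv, Equiv.symm_swap]
  by_cases h1 : x = i
  · subst h1; simp [hj, hi]
  · by_cases h2 : x = j
    · subst h2; simp [hj, hi]
    · simp [Equiv.swap_apply_of_ne_of_ne h1 h2]

section Desirability

variable {N : Type*} [Fintype N] [DecidableEq N] (G : SimpleGame N)

/-- The winning coalitions that contain player `i`. -/
def winningWith (i : N) : Set (Finset N) := {S | S ∈ G.W ∧ i ∈ S}

/-- The desirability relation `i ≿ j`: the transposition of `i` and `j` maps every winning
coalition containing `j` to a winning coalition containing `i`. -/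
def Desirable (i j : N) : Prop :=
  (fun S : Finset N => S.map (Equiv.swap i j).toEmbedding) '' G.winningWith j ⊆ G.winningWith i

theorem desirable_iff (i j : N) :
    G.Desirable i j ↔ ∀ S ∈ G.W, j ∈ S → i ∉ S → insert i (S.erase j) ∈ G.W := by
  constructor
  · intro h S hS hj hi
    have := h ⟨S, ⟨hS, hj⟩, rfl⟩
    simp only [map_swap_of_notMem hi hj] at this
    exact this.1
  · rintro h _ ⟨S, ⟨hS, hj⟩, rfl⟩
    by_cases hi : i ∈ S
    · simp only [map_swap_of_mem hi hj]
      exact ⟨hS, hi⟩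
    · simp only [map_swap_of_notMem hi hj]
      exact ⟨h S hS hj hi, Finset.mem_insert_self _ _⟩

theorem desirable_refl (i : N) : G.Desirable i i :=
  (G.desirable_iff i i).2 fun _ _ hj hi => absurd hj hi

theorem desirable_trans {i j k : N} (hij : G.Desirable i j) (hjk : G.Desirable j k) :
    G.Desirable i k := by
  rw [desirable_iff] at *
  intro S hS hk hi
  by_cases hj : j ∈ S
  · by_cases hjk' : j = k
    · subst hjk'; exact hij S hS hj hi
    have hik : k ≠ i := fun h => hi (h ▸ hk)
    have h1 := hij S hS hj hi
    have hji : j ≠ i := fun h => hi (h ▸ hj)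
    have h2 := hjk _ h1 (by simp [hk, Ne.symm hjk']) (by simp [hji])
    convert h2 using 1
    ext x
    simp only [Finset.mem_insert, Finset.mem_erase]
    grind
  · by_cases hij' : i = j
    · subst hij'; exact hjk S hS hk hi
    have h1 := hjk S hS hk hj
    have h2 := hij _ h1 (by simp) (by simp [hi, hij'])
    convert h2 using 1
    ext x
    simp only [Finset.mem_insert, Finset.mem_erase]
    grind

/-- Equi-desirability `i ≈ j` of players. -/
def equiDesirable : Setoid N where
  r i j := G.Desirable i j ∧ G.Desirable j i
  iseqv :=
    { refl := fun i => ⟨G.desirable_refl i, G.desirable_refl i⟩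
      symm := fun h => ⟨h.2, h.1⟩
      trans := fun h h' => ⟨G.desirable_trans h.1 h'.1, G.desirable_trans h'.2 h.2⟩ }

/-- The set `N/≈` of classes of equi-desirable players. -/
def PlayerClass : Type _ := Quotient G.equiDesirable

/-- The class of a player. -/
def classOf (i : N) : G.PlayerClass := Quotient.mk G.equiDesirable i

open Classical in
noncomputable instance : Fintype G.PlayerClass :=
  Fintype.ofSurjective G.classOf Quotient.mk_surjective

/-- The order `p ≥ q` on classes: every player in `p` is at least as desirable as every player
in `q`. In a complete game, in particular in a weighted game, it is a linear order. -/
def ClassGE (p q : G.PlayerClass) : Prop :=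
  ∀ i j : N, G.classOf i = p → G.classOf j = q → G.Desirable i j

open Classical in
/-- The number of members of the coalition `S` in the class `c`. -/
noncomputable def countIn (S : Finset N) (c : G.PlayerClass) : ℕ :=
  (S.filter fun i => G.classOf i = c).card

/-- The vectors: `0 ≤ m c ≤ |c|` for every class `c`. A vector describes the type of a coalition.
Coordinates are indexed by the classes themselves, so that no numbering of them is needed. -/
def IsVector (m : G.PlayerClass → ℕ) : Prop :=
  ∀ c, m c ≤ G.countIn Finset.univ c

/-- A winning vector: the coalitions with exactly `m c` members in each class `c` are winning. -/
def IsWinningVector (m : G.PlayerClass → ℕ) : Prop :=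
  G.IsVector m ∧ ∀ S : Finset N, (∀ c, G.countIn S c = m c) → S ∈ G.W

/-- A losing vector: the coalitions with exactly `m c` members in each class `c` are losing. -/
def IsLosingVector (m : G.PlayerClass → ℕ) : Prop :=
  G.IsVector m ∧ ∀ S : Finset N, (∀ c, G.countIn S c = m c) → S ∉ G.W

open Classical in
/-- The partial sum of `m` from the most desirable class down to the class `k` (inclusive). -/
noncomputable def partialSum (m : G.PlayerClass → ℕ) (k : G.PlayerClass) : ℕ :=
  ∑ c ∈ Finset.univ.filter (fun c => G.ClassGE c k), m c

/-- The order `a ⪰ b` on vectors: all partial sums of `a` dominate those of `b`. -/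
def ShiftGE (a b : G.PlayerClass → ℕ) : Prop :=
  ∀ k, G.partialSum b k ≤ G.partialSum a k

/-- A shift-maximal losing vector: a losing vector `m` such that every vector `m' ≻ m` is
winning. -/
def IsShiftMaximalLosing (m : G.PlayerClass → ℕ) : Prop :=
  G.IsLosingVector m ∧
    ∀ m' : G.PlayerClass → ℕ, G.IsVector m' → G.ShiftGE m' m → m' ≠ m → G.IsWinningVector m'

/-- The number of shift-maximal losing vectors. -/
noncomputable def numShiftMaximalLosing : ℕ :=
  {m : G.PlayerClass → ℕ | G.IsShiftMaximalLosing m}.ncard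

end Desirability

/-- The number, up to isomorphism, of weighted games with `n` players and exactly `r`
shift-maximal losing vectors. -/
noncomputable def numWeightedDual (n r : ℕ) : ℕ :=
  (Quotient.mk (isoSetoid (Fin n)) ''
    {G : SimpleGame (Fin n) | G.IsWeighted ∧ G.numShiftMaximalLosing = r}).ncard

end SimpleGame

/-! Since desirability is total, winning is monotone for the shift order, and by finiteness every
losing coalition lies below a maximal losing one. A single shift-maximal losing vector is therefore
a greatest losing vector, and it determines the whole game. Number the players by decreasing
desirability and push a coalition of that type as far forward as possible inside each class. This
gives a set `L`, not the whole of `N`, such that `S` loses exactly when no prefix contains more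
members of `S` than of `L` (`exists_iso_principalGame`). Different sets `L` give non-isomorphic
games (`principalGame_iso_iff`), so the games correspond to 0-1 words of length `n` other than the
all-ones word.

Weightedness is a pattern condition on the word (`isWeighted_principalGame_iff`). An occurrence of
101100 or 101010 yields a trade turning two losing coalitions into two winning ones with the same
total weight. A word avoiding both has the form 0^p 1^a 0^b 1^c 0^d 1^q with `c = 1` or `d ≤ 1`, for
which explicit weights exist. Counting these words by their first letter gives a quartic polynomial,
and the all-ones word is subtracted. -/

namespace SimpleGame

/-! ### The shift order on coalitions and the greatest losing coalition -/

section Complete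

variable {N : Type*} [Fintype N] [DecidableEq N] (G : SimpleGame N)

open Classical in
/-- The number of members of `S` that are at least as desirable as `j`. -/
noncomputable def upCount (S : Finset N) (j : N) : ℕ := (S.filter fun i => G.Desirable i j).card

/-- The shift order on coalitions. -/
def Dominates (S T : Finset N) : Prop := ∀ j, G.upCount T j ≤ G.upCount S j

variable {G}

theorem Dominates.trans {S T U : Finset N} (h : G.Dominates S T) (h' : G.Dominates T U) :
    G.Dominates S U := fun j => (h' j).trans (h j)

variable (G)

theorem classOf_eq_classOf {i j : N} :
    G.classOf i = G.classOf j ↔ G.Desirable i j ∧ G.Desirable j i :=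
  Quotient.eq (r := G.equiDesirable)

theorem exists_classOf_eq (c : G.PlayerClass) : ∃ i, G.classOf i = c :=
  Quotient.mk_surjective c

theorem classGE_classOf {i j : N} :
    G.ClassGE (G.classOf i) (G.classOf j) ↔ G.Desirable i j := by
  refine ⟨fun h => h i j rfl rfl, fun h i' j' hi hj => ?_⟩
  rw [classOf_eq_classOf] at hi hj
  exact G.desirable_trans hi.1 (G.desirable_trans h hj.2)

theorem classGE_trans {a b c : G.PlayerClass} (h : G.ClassGE a b) (h' : G.ClassGE b c) :
    G.ClassGE a c := by
  obtain ⟨i, rfl⟩ := G.exists_classOf_eq a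
  obtain ⟨j, rfl⟩ := G.exists_classOf_eq b
  obtain ⟨k, rfl⟩ := G.exists_classOf_eq c
  rw [classGE_classOf] at *
  exact G.desirable_trans h h'

theorem classGE_refl (a : G.PlayerClass) : G.ClassGE a a := by
  obtain ⟨i, rfl⟩ := G.exists_classOf_eq a
  exact G.classGE_classOf.2 (G.desirable_refl i)

theorem classGE_antisymm {a b : G.PlayerClass} (h : G.ClassGE a b) (h' : G.ClassGE b a) :
    a = b := by
  obtain ⟨i, rfl⟩ := G.exists_classOf_eq a
  obtain ⟨j, rfl⟩ := G.exists_classOf_eq b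
  rw [classGE_classOf] at *
  exact G.classOf_eq_classOf.2 ⟨h, h'⟩

theorem partialSum_countIn (S : Finset N) (j : N) :
    G.partialSum (G.countIn S) (G.classOf j) = G.upCount S j := by
  classical
  unfold partialSum upCount
  rw [Finset.card_eq_sum_card_fiberwise (f := G.classOf)
    (t := Finset.univ.filter fun c => G.ClassGE c (G.classOf j))]
  · refine Finset.sum_congr rfl fun c hc => ?_
    unfold countIn
    congr 1
    ext i
    simp only [Finset.mem_filter, Finset.mem_univ, true_and] at hc ⊢
    constructor
    · rintro ⟨h, rfl⟩
      exact ⟨⟨h, G.classGE_classOf.1 hc⟩, rfl⟩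
    · rintro ⟨⟨h, -⟩, rfl⟩
      exact ⟨h, rfl⟩
  · intro i hi
    simp only [Finset.coe_filter, Set.mem_ofPred_eq, Finset.mem_univ, true_and] at hi ⊢
    exact G.classGE_classOf.2 hi.2

theorem shiftGE_countIn {S T : Finset N} :
    G.ShiftGE (G.countIn S) (G.countIn T) ↔ G.Dominates S T := by
  constructor
  · intro h j
    simpa only [partialSum_countIn] using h (G.classOf j)
  · intro h k
    obtain ⟨j, rfl⟩ := G.exists_classOf_eq k
    simpa only [partialSum_countIn] using h j

theorem isVector_countIn (S : Finset N) : G.IsVector (G.countIn S) := by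
  classical
  exact fun _ => Finset.card_le_card (Finset.filter_subset_filter _ (Finset.subset_univ S))

theorem exists_countIn_eq {m : G.PlayerClass → ℕ} (hm : G.IsVector m) :
    ∃ S, G.countIn S = m := by
  classical
  have hex : ∀ c, ∃ T ⊆ Finset.univ.filter (fun i => G.classOf i = c), T.card = m c := fun c =>
    Finset.exists_subset_card_eq (by have := hm c; unfold countIn at this; convert this)
  choose T hT hc using hex
  refine ⟨Finset.univ.filter fun i => i ∈ T (G.classOf i), funext fun c => ?_⟩
  rw [← hc c]
  unfold countIn
  congr 1
  ext i
  simp only [Finset.mem_filter, Finset.mem_univ, true_and]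
  constructor
  · rintro ⟨h, rfl⟩
    exact h
  · intro h
    have := hT c h
    simp only [Finset.mem_filter, Finset.mem_univ, true_and] at this
    exact ⟨this ▸ h, this⟩

/-- Equal partial sums determine the coordinates from the top class downwards; the induction is on
the number of classes at or above `c`. -/
theorem shiftGE_antisymm {a b : G.PlayerClass → ℕ} (h : G.ShiftGE a b) (h' : G.ShiftGE b a) :
    a = b := by
  classical
  funext c
  induction hd : (Finset.univ.filter fun c' => G.ClassGE c' c).card using
    Nat.strong_induction_on generalizing c with
  | _ d ih =>
    have hsum := le_antisymm (h' c) (h c)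
    have hc : c ∈ Finset.univ.filter fun c' => G.ClassGE c' c := by
      simpa using G.classGE_refl c
    unfold partialSum at hsum
    rw [← Finset.add_sum_erase _ _ hc, ← Finset.add_sum_erase _ _ hc] at hsum
    have : ∑ x ∈ (Finset.univ.filter fun c' => G.ClassGE c' c).erase c, a x =
        ∑ x ∈ (Finset.univ.filter fun c' => G.ClassGE c' c).erase c, b x := by
      refine Finset.sum_congr rfl fun x hx => ?_
      simp only [Finset.mem_erase, Finset.mem_filter, Finset.mem_univ, true_and] at hx
      refine ih _ ?_ x rfl
      rw [← hd]
      refine Finset.card_lt_card (Finset.ssubset_iff_subset_ne.2 ⟨fun y hy => ?_, fun he => ?_⟩)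
      · simp only [Finset.mem_filter, Finset.mem_univ, true_and] at hy ⊢
        exact G.classGE_trans hy hx.2
      · rw [← he] at hc
        simp only [Finset.mem_filter, Finset.mem_univ, true_and] at hc
        exact hx.1 (G.classGE_antisymm hx.2 hc)
    omega

section Ranked

variable {G} {α : Type*} [LinearOrder α] {r : N → α}

/-- Exchange argument: trade a member of `T \ S` for an equally or more desirable member of `S \ T`.
`T` stays winning and dominated by `S`, while `T \ S` shrinks, until `T ⊆ S`. A small rank `r` means
a desirable player. -/
theorem mem_W_of_dominates (hr : ∀ i j, r i ≤ r j → G.Desirable i j) {S T : Finset N}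
    (h : G.Dominates S T) (hT : T ∈ G.W) : S ∈ G.W := by
  classical
  induction hd : (T \ S).card using Nat.strong_induction_on generalizing T with
  | _ d ih =>
    by_cases hsub : T ⊆ S
    · exact G.mono hT hsub
    -- Taking `j` most desirable in `T \ S` keeps domination intact: at a level `k` that `i` reaches
    -- but `j` does not, all members of `T` counted already lie in `S`.
    obtain ⟨j, hj, hmin⟩ := Finset.exists_min_image (T \ S) r (Finset.sdiff_nonempty.2 hsub)
    obtain ⟨hjT, hjS⟩ := Finset.mem_sdiff.1 hj
    have hi : ∃ i ∈ S, i ∉ T ∧ G.Desirable i j := by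
      by_contra! hcon
      refine absurd (h j) (not_le.2 (Finset.card_lt_card
        (Finset.ssubset_iff_subset_ne.2 ⟨fun i hi => ?_, fun he => ?_⟩)))
      · rw [Finset.mem_filter] at hi ⊢
        refine ⟨?_, hi.2⟩
        by_contra hiT
        exact hcon i hi.1 hiT hi.2
      · have : j ∈ T.filter fun i => G.Desirable i j :=
          Finset.mem_filter.2 ⟨hjT, G.desirable_refl j⟩
        rw [← he, Finset.mem_filter] at this
        exact hjS this.1
    obtain ⟨i, hiS, hiT, hij⟩ := hi
    have hT' := (G.desirable_iff i j).1 hij T hT hjT hiT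
    refine ih _ ?_ (fun k => ?_) hT' rfl
    · rw [← hd]
      refine Finset.card_lt_card (Finset.ssubset_iff_subset_ne.2 ⟨fun x hx => ?_, fun he => ?_⟩)
      · simp only [Finset.mem_sdiff, Finset.mem_insert, Finset.mem_erase] at hx ⊢
        grind
      · rw [← he] at hj
        simp only [Finset.mem_sdiff, Finset.mem_insert, Finset.mem_erase] at hj
        grind
    · unfold upCount
      by_cases hjk : G.Desirable j k
      · refine le_trans ?_ (h k)
        have hsub' : (insert i (T.erase j)).filter (fun x => G.Desirable x k) ⊆
            insert i ((T.filter fun x => G.Desirable x k).erase j) := by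
          intro x hx
          simp only [Finset.mem_filter, Finset.mem_insert, Finset.mem_erase] at hx ⊢
          tauto
        refine (Finset.card_le_card hsub').trans ((Finset.card_insert_le _ _).trans ?_)
        rw [Finset.card_erase_add_one]
        · rfl
        · exact Finset.mem_filter.2 ⟨hjT, hjk⟩
      · by_cases hik : G.Desirable i k
        · refine Finset.card_le_card fun x hx => ?_
          simp only [Finset.mem_filter, Finset.mem_insert, Finset.mem_erase] at hx ⊢
          refine ⟨?_, hx.2⟩
          rcases hx.1 with rfl | hxT
          · exact hiS
          · by_contra hxS
            exact hjk (G.desirable_trans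
              (hr j x (hmin x (Finset.mem_sdiff.2 ⟨hxT.2, hxS⟩))) hx.2)
        · refine le_trans (Finset.card_le_card fun x hx => ?_) (h k)
          simp only [Finset.mem_filter, Finset.mem_insert, Finset.mem_erase] at hx ⊢
          refine ⟨?_, hx.2⟩
          rcases hx.1 with rfl | hxT
          · exact absurd hx.2 hik
          · exact hxT.2

theorem exists_maximal_losing {S : Finset N} (hS : S ∉ G.W) :
    ∃ T ∉ G.W, G.Dominates T S ∧ ∀ U ∉ G.W, G.Dominates U T → G.Dominates T U := by
  classical
  -- The sum of all up-counts is a potential that increases with domination, strictly unless all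
  -- up-counts agree.
  obtain ⟨T, hT, hmax⟩ := Finset.exists_max_image
    (Finset.univ.filter fun T => T ∉ G.W ∧ G.Dominates T S) (fun T => ∑ j, G.upCount T j)
    ⟨S, by simp only [Finset.mem_filter, Finset.mem_univ, true_and]; exact ⟨hS, fun _ => le_rfl⟩⟩
  simp only [Finset.mem_filter, Finset.mem_univ, true_and] at hT hmax
  refine ⟨T, hT.1, hT.2, fun U hU hUT => ?_⟩
  have h1 := hmax U ⟨hU, hUT.trans hT.2⟩
  have h2 : ∑ j, G.upCount T j ≤ ∑ j, G.upCount U j := Finset.sum_le_sum fun j _ => hUT j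
  have h3 := (Finset.sum_eq_sum_iff_of_le fun j _ => hUT j).1 (le_antisymm h2 h1)
  exact fun j => (h3 j (Finset.mem_univ j)).ge

/-- In a finite preorder where everything lies below a maximal element, a unique maximal element is
a greatest one, and conversely by antisymmetry on vectors. -/
theorem numShiftMaximalLosing_eq_one_iff (hr : ∀ i j, r i ≤ r j → G.Desirable i j) :
    G.numShiftMaximalLosing = 1 ↔ ∃ S₀ ∉ G.W, ∀ S ∉ G.W, G.Dominates S₀ S := by
  have hlose : ∀ S T, G.countIn S = G.countIn T → T ∉ G.W → S ∉ G.W := by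
    intro S T h hT hS
    refine hT (mem_W_of_dominates hr (G.shiftGE_countIn.1 ?_) hS)
    rw [h]
    exact fun _ => le_rfl
  unfold numShiftMaximalLosing
  rw [Set.ncard_eq_one]
  constructor
  · rintro ⟨m, hm⟩
    have hmm : G.IsShiftMaximalLosing m := by
      have : m ∈ {m | G.IsShiftMaximalLosing m} := by rw [hm]; rfl
      exact this
    obtain ⟨S₀, rfl⟩ := G.exists_countIn_eq hmm.1.1
    refine ⟨S₀, hmm.1.2 S₀ fun _ => rfl, fun S hS => ?_⟩
    obtain ⟨T, hT, hTS, hmax⟩ := exists_maximal_losing hS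
    have hTm : G.IsShiftMaximalLosing (G.countIn T) := by
      refine ⟨⟨G.isVector_countIn T, fun U hU => hlose U T (funext hU) hT⟩,
        fun m' hm' hge hne => ⟨hm', fun U hU => ?_⟩⟩
      obtain rfl : G.countIn U = m' := funext hU
      by_contra hUW
      exact hne (G.shiftGE_antisymm hge
        (G.shiftGE_countIn.2 (hmax U hUW (G.shiftGE_countIn.1 hge))))
    have hTS₀ : G.countIn T ∈ ({G.countIn S₀} : Set _) := by rw [← hm]; exact hTm
    rw [Set.mem_singleton_iff] at hTS₀
    refine Dominates.trans (G.shiftGE_countIn.1 ?_) hTS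
    rw [hTS₀]
    exact fun _ => le_rfl
  · rintro ⟨S₀, hS₀, htop⟩
    have hm : G.IsShiftMaximalLosing (G.countIn S₀) := by
      refine ⟨⟨G.isVector_countIn S₀, fun U hU => hlose U S₀ (funext hU) hS₀⟩,
        fun m' hm' hge hne => ⟨hm', fun U hU => ?_⟩⟩
      obtain rfl : G.countIn U = m' := funext hU
      by_contra hUW
      exact hne (G.shiftGE_antisymm hge (G.shiftGE_countIn.2 (htop U hUW)))
    refine ⟨G.countIn S₀, Set.eq_singleton_iff_unique_mem.2 ⟨hm, fun m' hm' => ?_⟩⟩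
    obtain ⟨S, rfl⟩ := G.exists_countIn_eq hm'.1.1
    have hS := hm'.1.2 S fun _ => rfl
    by_contra hne
    exact hS₀ ((hm'.2 _ hm.1.1 (G.shiftGE_countIn.2 (htop S hS)) (Ne.symm hne)).2 S₀ fun _ => rfl)

end Ranked

end Complete

end SimpleGame

namespace SimpleGame

/-! ### Normal form: principal games and their isomorphisms -/

section Principal

variable {n : ℕ}

/-- The number of members of `S` among the first `k` players. -/
def prefixCount (S : Finset (Fin n)) (k : ℕ) : ℕ := (S.filter fun i => i.val < k).card

theorem prefixCount_le_of_injOn {S T : Finset (Fin n)} (f : Fin n → Fin n)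
    (hf : Set.InjOn f S) (hT : ∀ i ∈ S, f i ∈ T) (hle : ∀ i ∈ S, f i ≤ i) (k : ℕ) :
    prefixCount S k ≤ prefixCount T k := by
  refine Finset.card_le_card_of_injOn f (fun i hi => ?_) (hf.mono fun i hi => ?_)
  · rw [Finset.mem_coe, Finset.mem_filter] at hi ⊢
    exact ⟨hT i hi.1, lt_of_le_of_lt (hle i hi.1) hi.2⟩
  · rw [Finset.mem_coe, Finset.mem_filter] at hi
    exact hi.1

theorem prefixCount_eq_card (S : Finset (Fin n)) {k : ℕ} (hk : n ≤ k) :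
    prefixCount S k = S.card := by
  unfold prefixCount
  rw [Finset.filter_true_of_mem fun i _ => lt_of_lt_of_le i.isLt hk]

theorem prefixCount_succ (S : Finset (Fin n)) (k : Fin n) :
    prefixCount S (k + 1) = prefixCount S k + if k ∈ S then 1 else 0 := by
  unfold prefixCount
  split_ifs with h
  · rw [← Finset.card_insert_of_notMem (a := k) (by simp)]
    congr 1
    ext i
    simp only [Finset.mem_filter, Finset.mem_insert, Fin.ext_iff]
    constructor
    · rintro ⟨h1, h2⟩
      rcases Nat.lt_succ_iff_lt_or_eq.1 h2 with h3 | h3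
      · exact Or.inr ⟨h1, h3⟩
      · exact Or.inl h3
    · rintro (h1 | ⟨h1, h2⟩)
      · obtain rfl := Fin.ext h1
        exact ⟨h, Nat.lt_succ_self _⟩
      · exact ⟨h1, by omega⟩
  · rw [add_zero]
    congr 1
    ext i
    simp only [Finset.mem_filter, and_congr_right_iff]
    intro hi
    have : i.val ≠ k.val := fun he => h (Fin.ext he ▸ hi)
    omega

theorem prefixCount_zero (S : Finset (Fin n)) : prefixCount S 0 = 0 := by
  simp [prefixCount]

theorem prefixCount_injective : Function.Injective (prefixCount : Finset (Fin n) → ℕ → ℕ) := by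
  intro S T h
  ext i
  have h1 := congrFun h i
  have h2 := congrFun h (i + 1)
  rw [prefixCount_succ, prefixCount_succ, h1] at h2
  by_cases hS : i ∈ S <;> by_cases hT : i ∈ T <;> simp_all

/-- The complete game in which a coalition loses exactly when `L` dominates it; the players are
ordered by desirability, the most desirable one first. -/
def principalGame (L : Finset (Fin n)) (hL : L ≠ Finset.univ) : SimpleGame (Fin n) where
  W := {S | ∃ k, prefixCount L k < prefixCount S k}
  empty_notMem := by
    rintro ⟨k, hk⟩
    simp [prefixCount] at hk
  univ_mem := by
    refine ⟨n, ?_⟩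
    rw [prefixCount_eq_card _ le_rfl, prefixCount_eq_card _ le_rfl]
    exact Finset.card_lt_card (Finset.ssubset_univ_iff.2 hL)
  mono := by
    rintro S T ⟨k, hk⟩ hST
    exact ⟨k, hk.trans_le (Finset.card_le_card (Finset.filter_subset_filter _ hST))⟩

theorem mem_principalGame {L : Finset (Fin n)} {hL : L ≠ Finset.univ} {S : Finset (Fin n)} :
    S ∈ (principalGame L hL).W ↔ ∃ k, prefixCount L k < prefixCount S k := Iff.rfl

theorem notMem_principalGame {L : Finset (Fin n)} {hL : L ≠ Finset.univ} {S : Finset (Fin n)} :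
    S ∉ (principalGame L hL).W ↔ ∀ k, prefixCount S k ≤ prefixCount L k := by
  rw [mem_principalGame]
  push Not
  rfl

theorem desirable_principalGame {L : Finset (Fin n)} (hL : L ≠ Finset.univ) {i j : Fin n}
    (hij : i ≤ j) : (principalGame L hL).Desirable i j := by
  rw [desirable_iff]
  rintro S ⟨k, hk⟩ hj hi
  refine ⟨k, hk.trans_le
    (prefixCount_le_of_injOn (fun x => if x = j then i else x) ?_ ?_ ?_ k)⟩
  · intro x hx y hy hxy
    rw [Finset.mem_coe] at hx hy
    grind
  · intro x hx
    simp only [Finset.mem_insert, Finset.mem_erase]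
    grind
  · intro x hx
    grind

theorem exists_forall_iff_lt (e : Equiv.Perm (Fin n)) {P : Fin n → Prop}
    (hP : ∀ i j, e i ≤ e j → P j → P i) : ∃ k, ∀ i, P i ↔ (e i).val < k := by
  classical
  refine ⟨(Finset.univ.filter P).sup fun i => (e i).val + 1, fun i => ?_⟩
  rw [Finset.lt_sup_iff]
  simp only [Finset.mem_filter, Finset.mem_univ, true_and]
  refine ⟨fun h => ⟨i, h, Nat.lt_succ_self _⟩, ?_⟩
  rintro ⟨j, hj, hlt⟩
  exact hP i j (Nat.lt_succ_iff.1 hlt) hj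

theorem prefixCount_map (e : Equiv.Perm (Fin n)) (S : Finset (Fin n)) (k : ℕ) :
    prefixCount (S.map e.toEmbedding) k = (S.filter fun i => (e i).val < k).card := by
  unfold prefixCount
  rw [Finset.filter_map, Finset.card_map]
  rfl

/-- The players at least as desirable as `j` form a prefix in the order `e`, so domination tests
only some of the prefixes. -/
theorem dominates_of_prefixCount_le {G : SimpleGame (Fin n)} {e : Equiv.Perm (Fin n)}
    (he : ∀ i j, e i ≤ e j → G.Desirable i j) {S T : Finset (Fin n)}
    (h : ∀ k, prefixCount (T.map e.toEmbedding) k ≤ prefixCount (S.map e.toEmbedding) k) :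
    G.Dominates S T := by
  classical
  intro j
  obtain ⟨k, hk⟩ := exists_forall_iff_lt e (P := fun i => G.Desirable i j)
    fun i i' hi hj => G.desirable_trans (he i i' hi) hj
  have := h k
  rw [prefixCount_map, prefixCount_map] at this
  unfold upCount
  convert this using 3 <;> exact hk _

theorem numShiftMaximalLosing_principalGame {L : Finset (Fin n)} (hL : L ≠ Finset.univ) :
    (principalGame L hL).numShiftMaximalLosing = 1 := by
  have hr : ∀ i j : Fin n, (Equiv.refl (Fin n)) i ≤ (Equiv.refl (Fin n)) j →
    (principalGame L hL).Desirable i j := fun i j h => desirable_principalGame hL h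
  rw [numShiftMaximalLosing_eq_one_iff hr]
  refine ⟨L, notMem_principalGame.2 fun _ => le_rfl, fun S hS => ?_⟩
  refine dominates_of_prefixCount_le hr fun k => ?_
  simpa using notMem_principalGame.1 hS k

/-- Domination compares counts only at ends of classes, a principal game at every prefix. The two
tests agree once `L` occupies the first places within each class. -/
theorem exists_iso_principalGame {G : SimpleGame (Fin n)} {e : Equiv.Perm (Fin n)}
    (he : ∀ i j, e i ≤ e j → G.Desirable i j) (h1 : G.numShiftMaximalLosing = 1) :
    ∃ (L : Finset (Fin n)) (hL : L ≠ Finset.univ), G.Iso (principalGame L hL) := by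
  classical
  obtain ⟨S₀, hS₀, htop⟩ := (numShiftMaximalLosing_eq_one_iff he).1 h1
  -- Minimising the sum of positions among the greatest losing coalitions forces `L` to the front of
  -- each class (`hcanon`).
  obtain ⟨L, hL, hmin⟩ := Finset.exists_min_image
    (Finset.univ.filter fun L => L ∉ G.W ∧ ∀ S ∉ G.W, G.Dominates L S)
    (fun L => ∑ i ∈ L, (e i).val)
    ⟨S₀, by simp only [Finset.mem_filter, Finset.mem_univ, true_and]; exact ⟨hS₀, htop⟩⟩
  simp only [Finset.mem_filter, Finset.mem_univ, true_and] at hL hmin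
  obtain ⟨hLW, hLtop⟩ := hL
  have hcanon : ∀ i j, e i < e j → G.Desirable j i → j ∈ L → i ∈ L := by
    intro i j hij hji hj
    by_contra hi
    have hne : i ≠ j := fun h => hi (h ▸ hj)
    have hW : insert i (L.erase j) ∉ G.W := by
      intro hW
      have := (G.desirable_iff j i).1 hji _ hW (Finset.mem_insert_self _ _) (by simp [hne.symm])
      rw [Finset.erase_insert (by simp [hi]), Finset.insert_erase hj] at this
      exact hLW this
    have hdom : G.Dominates (insert i (L.erase j)) L := by
      intro k
      unfold upCount
      refine Finset.card_le_card_of_injOn (fun x => if x = j then i else x) ?_ ?_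
      · intro x hx
        simp only [Finset.coe_filter, Set.mem_ofPred_eq, Finset.mem_insert, Finset.mem_erase] at hx ⊢
        split_ifs with h
        · subst h
          exact ⟨Or.inl rfl, G.desirable_trans (he _ _ hij.le) hx.2⟩
        · exact ⟨Or.inr ⟨h, hx.1⟩, hx.2⟩
      · intro x hx y hy hxy
        simp only [Finset.coe_filter, Set.mem_ofPred_eq] at hx hy
        grind
    have := hmin _ ⟨hW, fun S hS => hdom.trans (hLtop S hS)⟩
    rw [Finset.sum_insert (by simp [hi]), ← Finset.add_sum_erase _ _ hj] at this
    have hij' : (e i).val < (e j).val := hij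
    omega
  refine ⟨L.map e.toEmbedding, fun h => hLW ?_, e, fun S => ?_⟩
  · have : L = Finset.univ := by
      rw [← Finset.map_univ_equiv e] at h
      exact Finset.map_injective _ h
    rw [this]
    exact G.univ_mem
  rw [← not_iff_not, notMem_principalGame]
  constructor
  · intro hS k
    rw [prefixCount_map, prefixCount_map]
    set A : Finset (Fin n) := Finset.univ.filter fun i => (e i).val < k with hA
    have hmemA : ∀ i, i ∈ A ↔ (e i).val < k := fun i => by simp [hA]
    by_cases hAL : A ⊆ L
    · refine Finset.card_le_card fun i hi => ?_
      rw [Finset.mem_filter] at hi ⊢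
      exact ⟨hAL ((hmemA i).2 hi.2), hi.2⟩
    -- For `x` the last player of the prefix missing from `L`, domination at `x` bounds the members
    -- of `S` at least as desirable as `x`. The less desirable players of the prefix all belong to
    -- `L`, and the members of `L` counted at `x` all lie in the prefix.
    obtain ⟨x, hx, hmax⟩ := Finset.exists_max_image (A \ L) e (Finset.sdiff_nonempty.2 hAL)
    obtain ⟨hxA, hxL⟩ := Finset.mem_sdiff.1 hx
    rw [hmemA] at hxA
    have hlater : ∀ y, (e y).val < k → ¬ G.Desirable y x → y ∈ L := by
      intro y hy hyx
      by_contra hyL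
      exact hyx (he _ _ (hmax y (Finset.mem_sdiff.2 ⟨(hmemA y).2 hy, hyL⟩)))
    have hearlier : ∀ y ∈ L, G.Desirable y x → (e y).val < k := by
      intro y hy hyx
      by_contra hlt
      exact hxL (hcanon x y (show (e x).val < (e y).val by omega) hyx hy)
    have hcard := hLtop S hS x
    unfold upCount at hcard
    set Q : Finset (Fin n) := A.filter fun i => ¬ G.Desirable i x with hQ
    have hmemQ : ∀ i, i ∈ Q ↔ (e i).val < k ∧ ¬ G.Desirable i x := fun i => by
      rw [hQ, Finset.mem_filter, hmemA]
    calc (S.filter fun i => (e i).val < k).card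
        ≤ (S.filter (fun i => G.Desirable i x) ∪ Q).card := by
          refine Finset.card_le_card fun i hi => ?_
          rw [Finset.mem_filter] at hi
          rw [Finset.mem_union, Finset.mem_filter, hmemQ]
          tauto
      _ ≤ (S.filter fun i => G.Desirable i x).card + Q.card := Finset.card_union_le _ _
      _ ≤ (L.filter fun i => G.Desirable i x).card + Q.card := by omega
      _ = (L.filter (fun i => G.Desirable i x) ∪ Q).card := by
          refine (Finset.card_union_of_disjoint (Finset.disjoint_left.2 fun i hi hi' => ?_)).symm
          rw [Finset.mem_filter] at hi
          exact ((hmemQ i).1 hi').2 hi.2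
      _ ≤ (L.filter fun i => (e i).val < k).card := by
          refine Finset.card_le_card fun i hi => ?_
          rw [Finset.mem_union, Finset.mem_filter, hmemQ] at hi
          rw [Finset.mem_filter]
          rcases hi with ⟨h, h'⟩ | ⟨h, h'⟩
          · exact ⟨h, hearlier i h h'⟩
          · exact ⟨hlater i h h', h⟩
  · intro h hS
    exact hLW (mem_W_of_dominates he (dominates_of_prefixCount_le he h) hS)

theorem IsWeighted.exists_perm {G : SimpleGame (Fin n)} (hG : G.IsWeighted) :
    ∃ e : Equiv.Perm (Fin n), ∀ i j, e i ≤ e j → G.Desirable i j := by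
  obtain ⟨w, q, -, -, hW⟩ := hG
  refine ⟨(Tuple.sort fun i => -w i).symm, fun i j hij => ?_⟩
  have hw := Tuple.monotone_sort (fun i => -w i) hij
  simp only [Function.comp_apply, Equiv.apply_symm_apply, neg_le_neg_iff] at hw
  rw [desirable_iff]
  intro S hS hj hi
  rw [hW] at hS ⊢
  rw [Finset.sum_insert (by simp [hi])]
  rw [← Finset.add_sum_erase _ _ hj] at hS
  linarith

theorem IsWeighted.of_iso {N N' : Type*} [Fintype N] [Fintype N'] {G : SimpleGame N}
    {G' : SimpleGame N'} (hG : G.IsWeighted) (h : G.Iso G') : G'.IsWeighted := by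
  obtain ⟨w, q, hw, hq, hW⟩ := hG
  obtain ⟨f, hf⟩ := h
  refine ⟨fun i => w (f.symm i), q, fun i => hw _, hq, fun S => ?_⟩
  have hS : S = (S.map f.symm.toEmbedding).map f.toEmbedding := by
    rw [Finset.map_map]
    simp
  conv_lhs => rw [hS, ← hf, hW]
  rw [Finset.sum_map]
  rfl

/-- Every set of `k` players contains a losing coalition of size `prefixCount L k`. Applied to the
preimage of the first `k` players, it gives a losing coalition of the second game inside that
prefix. -/
theorem prefixCount_le_of_iso {L L' : Finset (Fin n)} {hL : L ≠ Finset.univ}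
    {hL' : L' ≠ Finset.univ} (h : (principalGame L hL).Iso (principalGame L' hL')) (k : ℕ) :
    prefixCount L k ≤ prefixCount L' k := by
  obtain ⟨f, hf⟩ := h
  have hkey : ∃ S : Finset (Fin n), (∀ i ∈ S, (f i).val < k) ∧ S.card = prefixCount L k ∧
      S ∉ (principalGame L hL).W := by
    set A : Finset (Fin n) := Finset.univ.filter fun i => i.val < k with hA
    set K : Finset (Fin n) := A.map f.symm.toEmbedding with hK
    have hcard : K.card = A.card := Finset.card_map _
    -- The increasing enumeration of `K` moves each position weakly to the right, so it sends part
    -- of `L` to a losing coalition. The size is that of `A`, as `k` may exceed `n`.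
    set g := K.orderEmbOfFin hcard with hg
    have hlt : ∀ i ∈ A, i.val < A.card := by
      intro i hi
      have : (Finset.Iic i).card ≤ A.card := Finset.card_le_card fun j hj => by
        simp only [hA, Finset.mem_filter, Finset.mem_univ, true_and, Finset.mem_Iic] at hi hj ⊢
        exact lt_of_le_of_lt hj hi
      rw [Fin.card_Iic] at this
      omega
    have hle : ∀ m (hm : m < A.card), m ≤ (g ⟨m, hm⟩).val := by
      intro m
      induction m with
      | zero => intro _; exact Nat.zero_le _
      | succ m ih =>
        intro hm
        have h1 := ih (by omega)
        have h2 : g ⟨m, by omega⟩ < g ⟨m + 1, hm⟩ := g.strictMono (Nat.lt_succ_self m)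
        have h3 : (g ⟨m, by omega⟩).val < (g ⟨m + 1, hm⟩).val := h2
        omega
    set φ : Fin n → Fin n := fun i => if h : i.val < A.card then g ⟨i.val, h⟩ else i with hφ
    have hφA : ∀ i (hi : i ∈ A), φ i = g ⟨i.val, hlt i hi⟩ := fun i hi => dif_pos (hlt i hi)
    have hLA : ∀ i ∈ L.filter (fun i => i.val < k), i ∈ A := fun i hi => by
      simpa [hA] using (Finset.mem_filter.1 hi).2
    refine ⟨(L.filter fun i => i.val < k).image φ, ?_, ?_, ?_⟩
    · intro i hi
      obtain ⟨j, hj, rfl⟩ := Finset.mem_image.1 hi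
      have : φ j ∈ K := by
        rw [hφA j (hLA j hj)]
        exact K.orderEmbOfFin_mem hcard _
      rw [hK, Finset.mem_map_equiv] at this
      simpa [hA] using this
    · refine Finset.card_image_of_injOn fun i hi j hj hij => ?_
      simp only [hφA i (hLA i hi), hφA j (hLA j hj)] at hij
      have := g.injective hij
      rw [Fin.mk.injEq] at this
      exact Fin.ext this
    · rw [notMem_principalGame]
      intro m
      refine (Finset.card_le_card (t := (L.filter fun i => i.val < m).image φ)
        fun x hx => ?_).trans Finset.card_image_le
      obtain ⟨hx1, hx2⟩ := Finset.mem_filter.1 hx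
      obtain ⟨j, hj, rfl⟩ := Finset.mem_image.1 hx1
      rw [hφA j (hLA j hj)] at hx2
      exact Finset.mem_image_of_mem _ (Finset.mem_filter.2
        ⟨(Finset.mem_filter.1 hj).1, (hle j.val (hlt j (hLA j hj))).trans_lt hx2⟩)
  obtain ⟨S, hSk, hcard, hS⟩ := hkey
  rw [hf, notMem_principalGame] at hS
  have := hS k
  rwa [prefixCount_map, Finset.filter_true_of_mem hSk, hcard] at this

theorem principalGame_iso_iff {L L' : Finset (Fin n)} {hL : L ≠ Finset.univ}
    {hL' : L' ≠ Finset.univ} :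
    (principalGame L hL).Iso (principalGame L' hL') ↔ L = L' := by
  constructor
  · intro h
    exact prefixCount_injective (funext fun k => le_antisymm (prefixCount_le_of_iso h k)
      (prefixCount_le_of_iso ((isoSetoid (Fin n)).symm h) k))
  · rintro rfl
    exact (isoSetoid (Fin n)).refl _

end Principal

end SimpleGame

namespace SimpleGame

/-! ### Weighted principal games and forbidden subwords -/

section Weighted

variable {n : ℕ}

/-- With `P` the part of `L` before `p₂`, the losing pair `L`, `P - p₁ + p₂ + q₁ + q₂` and the
winning pair `P + p₂`, `L - p₁ + q₁ + q₂` have the same total weight. Leaving the order of `r` and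
`q₁` open covers both forbidden words. -/
theorem not_isWeighted_principalGame {L : Finset (Fin n)} (hL : L ≠ Finset.univ)
    {p₁ p₂ p₃ r q₁ q₂ : Fin n} (h12 : p₁ < p₂) (h23 : p₂ < p₃) (h3r : p₃ < r) (hrq : r < q₂)
    (h3q : p₃ < q₁) (hqq : q₁ < q₂) (hp₁ : p₁ ∈ L) (hp₂ : p₂ ∉ L) (hp₃ : p₃ ∈ L) (hr : r ∈ L)
    (hq₁ : q₁ ∉ L) (hq₂ : q₂ ∉ L) : ¬ (principalGame L hL).IsWeighted := by
  rintro ⟨w, q, -, -, hW⟩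
  set P : Finset (Fin n) := L.filter fun i => i < p₂ with hP
  have hmemP : ∀ i, i ∈ P ↔ i ∈ L ∧ i < p₂ := fun i => by rw [hP, Finset.mem_filter]
  have hp₁P : p₁ ∈ P := (hmemP _).2 ⟨hp₁, h12⟩
  have n₂P : p₂ ∉ P.erase p₁ := by simp [hmemP]
  have n₃P : q₁ ∉ insert p₂ (P.erase p₁) := by
    simp only [Finset.mem_insert, Finset.mem_erase, hmemP]
    grind
  have n₄P : q₂ ∉ insert q₁ (insert p₂ (P.erase p₁)) := by
    simp only [Finset.mem_insert, Finset.mem_erase, hmemP]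
    grind
  have n₃L : q₁ ∉ L.erase p₁ := by simp [hq₁]
  have n₄L : q₂ ∉ insert q₁ (L.erase p₁) := by
    simp only [Finset.mem_insert, Finset.mem_erase]
    grind
  have hL₀ : L ∉ (principalGame L hL).W := notMem_principalGame.2 fun _ => le_rfl
  have hL₁ : insert q₂ (insert q₁ (insert p₂ (P.erase p₁))) ∉ (principalGame L hL).W := by
    refine notMem_principalGame.2 (prefixCount_le_of_injOn
      -- Moving `p₂`, `q₁`, `q₂` forward to `p₁`, `p₃`, `r` lands in `L`.
      (fun x => if x = p₂ then p₁ else if x = q₁ then p₃ else if x = q₂ then r else x) ?_ ?_ ?_)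
    · intro x hx y hy hxy
      simp only [Finset.mem_coe, Finset.mem_insert, Finset.mem_erase, hmemP] at hx hy
      dsimp only at hxy
      clear hW
      split_ifs at hxy <;> grind
    · intro x hx
      simp only [Finset.mem_insert, Finset.mem_erase, hmemP] at hx
      grind
    · intro x hx
      grind
  have hT₁ : insert p₂ P ∈ (principalGame L hL).W := by
    refine mem_principalGame.2 ⟨p₂ + 1, ?_⟩
    rw [prefixCount_succ, prefixCount_succ, if_neg hp₂, if_pos (Finset.mem_insert_self _ _),
      add_zero, Nat.lt_succ_iff]
    refine Finset.card_le_card fun i hi => ?_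
    rw [Finset.mem_filter] at hi ⊢
    exact ⟨Finset.mem_insert_of_mem ((hmemP i).2 hi), hi.2⟩
  have hT₂ : insert q₂ (insert q₁ (L.erase p₁)) ∈ (principalGame L hL).W := by
    refine mem_principalGame.2 ⟨n, ?_⟩
    rw [prefixCount_eq_card _ le_rfl, prefixCount_eq_card _ le_rfl,
      Finset.card_insert_of_notMem n₄L, Finset.card_insert_of_notMem n₃L,
      Finset.card_erase_add_one hp₁]
    exact Nat.lt_succ_self _
  rw [hW, not_le] at hL₀ hL₁
  rw [hW] at hT₁ hT₂
  rw [Finset.sum_insert n₄P, Finset.sum_insert n₃P, Finset.sum_insert n₂P] at hL₁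
  rw [Finset.sum_insert n₄L, Finset.sum_insert n₃L] at hT₂
  rw [Finset.sum_insert (by simp [hmemP])] at hT₁
  rw [← Finset.add_sum_erase _ _ hp₁] at hL₀
  rw [← Finset.add_sum_erase _ _ hp₁P] at hT₁
  linarith

theorem prefixCount_mono (S : Finset (Fin n)) {j k : ℕ} (h : j ≤ k) :
    prefixCount S j ≤ prefixCount S k :=
  Finset.card_le_card fun i hi => by
    rw [Finset.mem_filter] at hi ⊢
    exact ⟨hi.1, hi.2.trans_le h⟩

theorem prefixCount_le_add (S : Finset (Fin n)) {j k : ℕ} (h : j ≤ k) (hk : k ≤ n) :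
    prefixCount S k ≤ prefixCount S j + (k - j) := by
  induction k, h using Nat.le_induction with
  | base => omega
  | succ k hjk ih =>
    have h1 := prefixCount_succ S ⟨k, hk⟩
    have h2 := ih (by omega)
    simp only at h1
    split_ifs at h1 <;> omega

theorem sum_ite_lt_eq_prefixCount (S : Finset (Fin n)) (k : ℕ) :
    ∑ i ∈ S, (if i.val < k then (1 : ℝ) else 0) = prefixCount S k := by
  rw [Finset.sum_boole]
  rfl

/-- Only the ends of the three zero blocks matter. The weights combine the indicators of these three
prefixes. -/
theorem isWeighted_principalGame {L : Finset (Fin n)} (hL : L ≠ Finset.univ) {p a b c d : ℕ}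
    (hn : p + a + b + c + d ≤ n) (hcd : c = 1 ∨ d ≤ 1)
    (hmem : ∀ i : Fin n, i ∈ L ↔ (p ≤ i.val ∧ i.val < p + a) ∨
      (p + a + b ≤ i.val ∧ i.val < p + a + b + c) ∨ p + a + b + c + d ≤ i.val) :
    (principalGame L hL).IsWeighted := by
  -- One truncated difference per block of ones; each vanishes before its block begins.
  have hl : ∀ k ≤ n, prefixCount L k = (min k (p + a) - p) +
      (min k (p + a + b + c) - (p + a + b)) + (k - (p + a + b + c + d)) := by
    intro k
    induction k with
    | zero => intro _; rw [prefixCount_zero]; omega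
    | succ k ih =>
      intro hk
      have h1 := prefixCount_succ L ⟨k, hk⟩
      have h2 := ih (by omega)
      simp only [hmem] at h1
      split_ifs at h1 <;> omega
  -- An excess of `S` over `L` persists to the end of a zero block, and one inside a block of ones
  -- was already present at its start.
  have hwin : ∀ S : Finset (Fin n), S ∈ (principalGame L hL).W ↔
      1 ≤ prefixCount S p ∨ a + 1 ≤ prefixCount S (p + a + b) ∨
        a + c + 1 ≤ prefixCount S (p + a + b + c + d) := by
    intro S
    rw [mem_principalGame]
    constructor
    · rintro ⟨k, hk⟩
      obtain ⟨k, hkn, hk⟩ : ∃ k ≤ n, prefixCount L k < prefixCount S k := by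
        rcases le_total k n with h | h
        · exact ⟨k, h, hk⟩
        · refine ⟨n, le_rfl, ?_⟩
          rwa [prefixCount_eq_card _ h, prefixCount_eq_card _ h,
            ← prefixCount_eq_card _ le_rfl, ← prefixCount_eq_card _ le_rfl] at hk
      rw [hl k hkn] at hk
      rcases le_total k p with h | h
      · have := prefixCount_mono S h
        omega
      rcases le_total k (p + a + b) with h' | h'
      · have := prefixCount_mono S h'
        have := prefixCount_le_add S h hkn
        omega
      rcases le_total k (p + a + b + c + d) with h'' | h''
      · have := prefixCount_mono S h''
        have := prefixCount_le_add S h' hkn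
        omega
      · have := prefixCount_le_add S h'' hkn
        omega
    · rintro (h | h | h)
      · exact ⟨p, by rw [hl _ (by omega)]; omega⟩
      · exact ⟨p + a + b, by rw [hl _ (by omega)]; omega⟩
      · exact ⟨p + a + b + c + d, by rw [hl _ (by omega)]; omega⟩
  have hweights : ∀ α β γ : ℕ, 0 < α → (∀ S : Finset (Fin n), S ∈ (principalGame L hL).W ↔
      α ≤ α * prefixCount S p + β * prefixCount S (p + a + b) +
        γ * prefixCount S (p + a + b + c + d)) → (principalGame L hL).IsWeighted := by
    intro α β γ hα h
    refine ⟨fun i => α * (if i.val < p then 1 else 0) + β * (if i.val < p + a + b then 1 else 0) +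
      γ * (if i.val < p + a + b + c + d then 1 else 0), α, fun i => by positivity,
      by exact_mod_cast hα, fun S => ?_⟩
    rw [h, Finset.sum_add_distrib, Finset.sum_add_distrib, ← Finset.mul_sum, ← Finset.mul_sum,
      ← Finset.mul_sum, sum_ite_lt_eq_prefixCount, sum_ite_lt_eq_prefixCount,
      sum_ite_lt_eq_prefixCount]
    norm_cast
  have h13 : ∀ S : Finset (Fin n), prefixCount S p ≤ prefixCount S (p + a + b) := fun S =>
    prefixCount_mono S (by omega)
  have h35 : ∀ S : Finset (Fin n),
      prefixCount S (p + a + b) ≤ prefixCount S (p + a + b + c + d) := fun S =>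
    prefixCount_mono S (by omega)
  have h53 : ∀ S : Finset (Fin n),
      prefixCount S (p + a + b + c + d) ≤ prefixCount S (p + a + b) + (c + d) := fun S => by
    have := prefixCount_le_add S (show p + a + b ≤ p + a + b + c + d by omega) hn
    omega
  rcases hcd with rfl | hd
  -- With `x`, `y`, `z` the three prefix counts, a losing coalition has `x = 0`, `y ≤ a`, `z ≤ a +
  -- 1`, so `y + (a + 1) * z` is at most the quota minus one. If `y ≥ a + 1`, then `z ≥ y` supplies
  -- the rest.
  · refine hweights ((a + 1) * (a + 2)) 1 (a + 1) (by positivity) fun S => ?_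
    rw [hwin]
    have h1 := h13 S
    have h2 := h35 S
    generalize prefixCount S p = x at *
    generalize prefixCount S (p + a + b) = y at *
    generalize prefixCount S (p + a + b + 1 + d) = z at *
    constructor
    · rintro (h | h | h)
      · nlinarith [Nat.mul_le_mul_left ((a + 1) * (a + 2)) h]
      · nlinarith [Nat.mul_le_mul_left (a + 1) (h.trans h2), Nat.zero_le ((a + 1) * (a + 2) * x)]
      · nlinarith [Nat.mul_le_mul_left (a + 1) h, Nat.zero_le ((a + 1) * (a + 2) * x)]
    · intro h
      by_contra! hc
      obtain ⟨hx, hy, hz⟩ := hc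
      obtain rfl : x = 0 := by omega
      nlinarith
  -- Losing means `x = 0`, `y ≤ a`, `z ≤ a + c`, so `c * y + z` again falls short of the quota by at
  -- least one. If `z ≥ a + c + 1`, then `d ≤ 1` forces `y ≥ a`.
  · refine hweights ((a + 1) * (c + 1)) c 1 (by positivity) fun S => ?_
    rw [hwin]
    have h1 := h13 S
    have h2 := h35 S
    have h3 := h53 S
    generalize prefixCount S p = x at *
    generalize prefixCount S (p + a + b) = y at *
    generalize prefixCount S (p + a + b + c + d) = z at *
    constructor
    · rintro (h | h | h)
      · nlinarith [Nat.mul_le_mul_left ((a + 1) * (c + 1)) h]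
      · nlinarith [Nat.mul_le_mul_left c h, Nat.zero_le ((a + 1) * (c + 1) * x)]
      · have hay : a ≤ y := by omega
        nlinarith [Nat.mul_le_mul_left c hay, Nat.zero_le ((a + 1) * (c + 1) * x)]
    · intro h
      by_contra! hc
      obtain ⟨hx, hy, hz⟩ := hc
      obtain rfl : x = 0 := by omega
      nlinarith

/-! ### Block structure of words avoiding the two patterns -/

open List

/-- The words that contain neither `101100` nor `101010` as a scattered subword. -/
def IsNarrow (l : List Bool) : Prop :=
  ¬ [true, false, true, true, false, false] <+ l ∧
    ¬ [true, false, true, false, true, false] <+ l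

theorem eq_replicate_of_not_sublist {l : List Bool} (h : ¬ [false] <+ l) :
    l = replicate l.length true := by
  rw [List.eq_replicate_iff]
  refine ⟨rfl, fun b hb => ?_⟩
  cases b
  · exact absurd (List.singleton_sublist.2 hb) h
  · rfl

theorem exists_eq_of_not_sublist_ff {l : List Bool} (h : ¬ [false, false] <+ l) :
    ∃ c d q, d ≤ 1 ∧ l = replicate c true ++ (replicate d false ++ replicate q true) := by
  induction l with
  | nil => exact ⟨0, 0, 0, by omega, rfl⟩
  | cons x l ih =>
    cases x
    · refine ⟨0, 1, l.length, le_rfl, ?_⟩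
      rw [List.cons_sublist_cons] at h
      simpa [replicate_succ] using eq_replicate_of_not_sublist h
    · obtain ⟨c, d, q, hd, hl⟩ := ih fun h' => h (h'.cons _)
      exact ⟨c + 1, d, q, hd, by rw [hl]; rfl⟩

theorem exists_eq_of_not_sublist_tf {l : List Bool} (h : ¬ [true, false] <+ l) :
    ∃ d q, l = replicate d false ++ replicate q true := by
  induction l with
  | nil => exact ⟨0, 0, rfl⟩
  | cons x l ih =>
    cases x
    · obtain ⟨d, q, hl⟩ := ih fun h' => h (h'.cons _)
      exact ⟨d + 1, q, by rw [hl]; rfl⟩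
    · refine ⟨0, l.length + 1, ?_⟩
      rw [List.cons_sublist_cons] at h
      simpa [replicate_succ] using eq_replicate_of_not_sublist h

/-- After the first 1, the next letter decides: a 0 leaves 10 to avoid and gives `c = 1`; a 1 leaves
00 to avoid and gives `d ≤ 1`. -/
theorem exists_eq_of_not_sublist_ttff {l : List Bool} (h : ¬ [true, true, false, false] <+ l)
    (h' : ¬ [true, false, true, false] <+ l) :
    ∃ b c d q, (c = 1 ∨ d ≤ 1) ∧ l = replicate b false ++ (replicate c true ++
      (replicate d false ++ replicate q true)) := by
  induction l with
  | nil => exact ⟨0, 0, 0, 0, by omega, rfl⟩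
  | cons x l ih =>
    cases x
    · obtain ⟨b, c, d, q, hcd, hl⟩ := ih (fun h₁ => h (h₁.cons _)) fun h₁ => h' (h₁.cons _)
      exact ⟨b + 1, c, d, q, hcd, by rw [hl]; rfl⟩
    · rw [List.cons_sublist_cons] at h h'
      cases l with
      | nil => exact ⟨0, 1, 0, 0, Or.inl rfl, rfl⟩
      | cons y l =>
        cases y
        · rw [List.cons_sublist_cons] at h'
          obtain ⟨d, q, hl⟩ := exists_eq_of_not_sublist_tf h'
          exact ⟨0, 1, d + 1, q, Or.inl rfl, by rw [hl]; rfl⟩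
        · rw [List.cons_sublist_cons] at h
          obtain ⟨c, d, q, hd, hl⟩ := exists_eq_of_not_sublist_ff h
          exact ⟨0, c + 2, d, q, Or.inr hd, by rw [hl]; rfl⟩

theorem exists_eq_of_not_sublist_fttff {l : List Bool}
    (h : ¬ [false, true, true, false, false] <+ l)
    (h' : ¬ [false, true, false, true, false] <+ l) :
    ∃ a b c d q, (c = 1 ∨ d ≤ 1) ∧ l = replicate a true ++ (replicate b false ++
      (replicate c true ++ (replicate d false ++ replicate q true))) := by
  induction l with
  | nil => exact ⟨0, 0, 0, 0, 0, by omega, rfl⟩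
  | cons x l ih =>
    cases x
    · rw [List.cons_sublist_cons] at h h'
      obtain ⟨b, c, d, q, hcd, hl⟩ := exists_eq_of_not_sublist_ttff h h'
      exact ⟨0, b + 1, c, d, q, hcd, by rw [hl]; rfl⟩
    · obtain ⟨a, b, c, d, q, hcd, hl⟩ := ih (fun h₁ => h (h₁.cons _)) fun h₁ => h' (h₁.cons _)
      exact ⟨a + 1, b, c, d, q, hcd, by rw [hl]; rfl⟩

theorem IsNarrow.exists_eq {l : List Bool} (h : IsNarrow l) :
    ∃ p a b c d q, (c = 1 ∨ d ≤ 1) ∧ l = replicate p false ++ (replicate a true ++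
      (replicate b false ++ (replicate c true ++ (replicate d false ++ replicate q true)))) := by
  obtain ⟨h, h'⟩ := h
  induction l with
  | nil => exact ⟨0, 0, 0, 0, 0, 0, by omega, rfl⟩
  | cons x l ih =>
    cases x
    · obtain ⟨p, a, b, c, d, q, hcd, hl⟩ :=
        ih (fun h₁ => h (h₁.cons _)) fun h₁ => h' (h₁.cons _)
      exact ⟨p + 1, a, b, c, d, q, hcd, by rw [hl]; rfl⟩
    · rw [List.cons_sublist_cons] at h h'
      obtain ⟨a, b, c, d, q, hcd, hl⟩ := exists_eq_of_not_sublist_fttff h h'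
      exact ⟨0, a + 1, b, c, d, q, hcd, by rw [hl]; rfl⟩

/-- The coalition whose indicator function is `v`. -/
def coalition (v : Fin n → Bool) : Finset (Fin n) := Finset.univ.filter fun i => v i = true

theorem mem_coalition {v : Fin n → Bool} {i : Fin n} : i ∈ coalition v ↔ v i = true := by
  simp [coalition]

theorem isWeighted_principalGame_iff {v : Fin n → Bool} (hv : coalition v ≠ Finset.univ) :
    (principalGame (coalition v) hv).IsWeighted ↔ IsNarrow (List.ofFn v) := by
  constructor
  · intro h
    constructor
    · intro hs
      obtain ⟨f, hf⟩ := sublist_iff_exists_fin_orderEmbedding_get_eq.1 hs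
      have hlt : ∀ i j : Fin 6, i < j →
          Fin.cast (List.length_ofFn (f := v)) (f i) < Fin.cast (List.length_ofFn (f := v)) (f j) :=
        fun i j hij => f.strictMono hij
      have hval : ∀ i : Fin 6, v (Fin.cast (List.length_ofFn (f := v)) (f i)) =
          [true, false, true, true, false, false].get i := fun i => by
        rw [hf i, List.get_ofFn]
      refine not_isWeighted_principalGame hv (hlt 0 1 (by decide)) (hlt 1 2 (by decide))
        (hlt 2 3 (by decide)) (hlt 3 5 (by decide)) (hlt 2 4 (by decide)) (hlt 4 5 (by decide))
        ?_ ?_ ?_ ?_ ?_ ?_ h <;> rw [mem_coalition, hval] <;> decide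
    · intro hs
      obtain ⟨f, hf⟩ := sublist_iff_exists_fin_orderEmbedding_get_eq.1 hs
      have hlt : ∀ i j : Fin 6, i < j →
          Fin.cast (List.length_ofFn (f := v)) (f i) < Fin.cast (List.length_ofFn (f := v)) (f j) :=
        fun i j hij => f.strictMono hij
      have hval : ∀ i : Fin 6, v (Fin.cast (List.length_ofFn (f := v)) (f i)) =
          [true, false, true, false, true, false].get i := fun i => by
        rw [hf i, List.get_ofFn]
      refine not_isWeighted_principalGame hv (hlt 0 1 (by decide)) (hlt 1 2 (by decide))
        (hlt 2 4 (by decide)) (hlt 4 5 (by decide)) (hlt 2 3 (by decide)) (hlt 3 5 (by decide))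
        ?_ ?_ ?_ ?_ ?_ ?_ h <;> rw [mem_coalition, hval] <;> decide
  · intro h
    obtain ⟨p, a, b, c, d, q, hcd, hl⟩ := h.exists_eq
    have hlen := congrArg List.length hl
    simp only [List.length_ofFn, List.length_append, List.length_replicate] at hlen
    refine isWeighted_principalGame hv (p := p) (a := a) (b := b) (c := c) (d := d) (by omega) hcd
      fun i => ?_
    have hi := congrArg (fun l : List Bool => l[i.val]?) hl
    simp only [List.getElem?_append, List.getElem?_replicate, List.length_replicate] at hi
    have := i.isLt
    rw [List.getElem?_eq_getElem (by simp), List.getElem_ofFn] at hi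
    rw [mem_coalition]
    simp only [Fin.eta] at hi
    split_ifs at hi <;> simp_all <;> omega

end Weighted

end SimpleGame

namespace SimpleGame

/-! ### Counting narrow words by their first letter -/

section Counting

open List

open Classical in
/-- The number of words of length `n` with the property `P`. -/
noncomputable def wordCount (P : List Bool → Prop) (n : ℕ) : ℕ :=
  (Finset.univ.filter fun v : Fin n → Bool => P (List.ofFn v)).card

theorem wordCount_zero {P : List Bool → Prop} (h : P []) : wordCount P 0 = 1 := by
  simp [wordCount, h]

theorem wordCount_congr {P Q : List Bool → Prop} (h : ∀ l, P l ↔ Q l) (n : ℕ) :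
    wordCount P n = wordCount Q n := by
  rw [show P = Q from funext fun l => propext (h l)]

theorem wordCount_succ (P : List Bool → Prop) (n : ℕ) :
    wordCount P (n + 1) =
      wordCount (fun l => P (true :: l)) n + wordCount (fun l => P (false :: l)) n := by
  classical
  unfold wordCount
  rw [Finset.card_filter, Finset.card_filter, Finset.card_filter,
    ← (Fin.consEquiv fun _ : Fin (n + 1) => Bool).sum_comp, Fintype.sum_prod_type,
    Fintype.sum_bool]
  simp [Fin.consEquiv, List.ofFn_succ]

theorem wordCount_f (n : ℕ) : wordCount (fun l => ¬ [false] <+ l) n = 1 := by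
  induction n with
  | zero => exact wordCount_zero (by simp)
  | succ n ih =>
    rw [wordCount_succ]
    have h : wordCount (fun l => ¬ [false] <+ false :: l) n = 0 := by simp [wordCount]
    rw [h, add_zero, ← ih]
    exact wordCount_congr (by simp) n

theorem wordCount_ff (n : ℕ) : wordCount (fun l => ¬ [false, false] <+ l) n = n + 1 := by
  induction n with
  | zero => exact wordCount_zero (by simp)
  | succ n ih =>
    rw [wordCount_succ]
    conv_rhs => rw [← ih, ← wordCount_f n]
    congr 1 <;> exact wordCount_congr (by simp [cons_sublist_cons']) n

theorem wordCount_tf (n : ℕ) : wordCount (fun l => ¬ [true, false] <+ l) n = n + 1 := by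
  induction n with
  | zero => exact wordCount_zero (by simp)
  | succ n ih =>
    rw [wordCount_succ, add_comm]
    conv_rhs => rw [← ih, ← wordCount_f n]
    congr 1
    · exact wordCount_congr (by simp [cons_sublist_cons']) n
    · exact wordCount_congr (fun l => by rw [List.cons_sublist_cons]) n

/-- Whichever letter comes first, the shortened pattern, 00 or 10, implies avoidance of the other
one. The length is `n + 1` because the empty word breaks the formula. -/
theorem wordCount_tff (n : ℕ) :
    wordCount (fun l => ¬ [true, false, false] <+ l ∧ ¬ [false, true, false] <+ l) (n + 1) =
      2 * (n + 1) := by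
  rw [wordCount_succ, two_mul]
  conv_rhs => rw [← wordCount_ff n]
  conv_rhs => arg 2; rw [wordCount_ff n, ← wordCount_tf n]
  congr 1
  · refine wordCount_congr (fun l => ?_) n
    rw [List.cons_sublist_cons, and_iff_left_of_imp]
    intro h h'
    exact h ((Sublist.cons_cons _ (Sublist.cons _ (Sublist.refl _))).trans
      ((List.cons_sublist_cons'.1 h').resolve_right (by simp)))
  · refine wordCount_congr (fun l => ?_) n
    rw [List.cons_sublist_cons, and_iff_right_of_imp]
    intro h h'
    exact h ((Sublist.cons_cons _ (Sublist.cons _ (Sublist.refl _))).trans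
      ((List.cons_sublist_cons'.1 h').resolve_right (by simp)))

theorem wordCount_ttff (n : ℕ) :
    wordCount (fun l => ¬ [true, true, false, false] <+ l ∧ ¬ [true, false, true, false] <+ l)
      (n + 1) = n ^ 2 + n + 2 := by
  have hrec : ∀ n, wordCount (fun l => ¬ [true, true, false, false] <+ l ∧
      ¬ [true, false, true, false] <+ l) (n + 1) =
      wordCount (fun l => ¬ [true, false, false] <+ l ∧ ¬ [false, true, false] <+ l) n +
      wordCount (fun l => ¬ [true, true, false, false] <+ l ∧
        ¬ [true, false, true, false] <+ l) n := fun n => by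
    rw [wordCount_succ]
    congr 1 <;> exact wordCount_congr (by simp [cons_sublist_cons']) n
  induction n with
  | zero =>
    rw [hrec, wordCount_zero, wordCount_zero] <;> simp
  | succ n ih =>
    rw [hrec, ih, wordCount_tff]
    ring

theorem wordCount_fttff (n : ℕ) :
    3 * wordCount (fun l => ¬ [false, true, true, false, false] <+ l ∧
      ¬ [false, true, false, true, false] <+ l) (n + 1) = n ^ 3 + 5 * n + 6 := by
  have hrec : ∀ n, wordCount (fun l => ¬ [false, true, true, false, false] <+ l ∧
      ¬ [false, true, false, true, false] <+ l) (n + 1) =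
      wordCount (fun l => ¬ [false, true, true, false, false] <+ l ∧
        ¬ [false, true, false, true, false] <+ l) n +
      wordCount (fun l => ¬ [true, true, false, false] <+ l ∧
        ¬ [true, false, true, false] <+ l) n := fun n => by
    rw [wordCount_succ]
    congr 1 <;> exact wordCount_congr (by simp [cons_sublist_cons']) n
  induction n with
  | zero =>
    rw [hrec, wordCount_zero, wordCount_zero] <;> simp
  | succ n ih =>
    rw [hrec, mul_add, ih, wordCount_ttff]
    ring

/-- A leading 0 cannot start either pattern; a leading 1 may be matched with the first letter of
both. The cubic term is on the left to avoid subtraction in `ℕ`. -/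
theorem wordCount_isNarrow (n : ℕ) :
    12 * wordCount IsNarrow (n + 1) + 2 * n ^ 3 = n ^ 4 + 11 * n ^ 2 + 14 * n + 24 := by
  have hrec : ∀ n, wordCount IsNarrow (n + 1) =
      wordCount (fun l => ¬ [false, true, true, false, false] <+ l ∧
        ¬ [false, true, false, true, false] <+ l) n + wordCount IsNarrow n := fun n => by
    rw [wordCount_succ]
    unfold IsNarrow
    congr 1 <;> exact wordCount_congr (by simp [cons_sublist_cons']) n
  induction n with
  | zero =>
    rw [hrec, wordCount_zero, wordCount_zero] <;> simp [IsNarrow]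
  | succ n ih =>
    rw [hrec]
    have := wordCount_fttff n
    nlinarith

theorem coalition_injective {n : ℕ} :
    Function.Injective (coalition : (Fin n → Bool) → Finset (Fin n)) := by
  intro v v' h
  funext i
  have : v i = true ↔ v' i = true := by rw [← mem_coalition, h, mem_coalition]
  exact Bool.eq_iff_iff.2 this

/-- The word removed is the all-ones word: it is narrow, but its coalition is `N`, which cannot
lose. -/
theorem numWeightedDual_one (n : ℕ) : numWeightedDual n 1 = wordCount IsNarrow n - 1 := by
  classical
  let φ : {v : Fin n → Bool // IsNarrow (List.ofFn v) ∧ coalition v ≠ Finset.univ} →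
      Quotient (isoSetoid (Fin n)) := fun v => Quotient.mk _ (principalGame (coalition v.1) v.2.2)
  have hφ : Function.Injective φ := fun v v' h =>
    Subtype.ext (coalition_injective (principalGame_iso_iff.1 (Quotient.exact h)))
  have hrange : Quotient.mk (isoSetoid (Fin n)) ''
      {G : SimpleGame (Fin n) | G.IsWeighted ∧ G.numShiftMaximalLosing = 1} = Set.range φ := by
    ext x
    constructor
    · rintro ⟨G, ⟨hw, h1⟩, rfl⟩
      obtain ⟨e, he⟩ := hw.exists_perm
      obtain ⟨L, hL, hiso⟩ := exists_iso_principalGame he h1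
      obtain ⟨v, rfl⟩ : ∃ v, coalition v = L :=
        ⟨fun i => decide (i ∈ L), by ext i; simp [mem_coalition]⟩
      exact ⟨⟨v, (isWeighted_principalGame_iff hL).1 (hw.of_iso hiso), hL⟩,
        (Quotient.sound hiso).symm⟩
    · rintro ⟨v, rfl⟩
      exact ⟨_, ⟨(isWeighted_principalGame_iff v.2.2).2 v.2.1,
        numShiftMaximalLosing_principalGame v.2.2⟩, rfl⟩
  have htrue : coalition (fun _ : Fin n => true) = Finset.univ := by
    ext i
    simp [mem_coalition]
  unfold numWeightedDual
  rw [hrange, Set.ncard_range_of_injective hφ, Nat.card_eq_fintype_card, Fintype.card_subtype]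
  unfold wordCount
  rw [← Finset.card_erase_of_mem (a := fun _ : Fin n => true)]
  · congr 1
    ext v
    simp only [Finset.mem_filter, Finset.mem_univ, true_and, Finset.mem_erase]
    rw [← htrue, coalition_injective.ne_iff, and_comm]
  · refine Finset.mem_filter.2 ⟨Finset.mem_univ _, ?_⟩
    constructor <;> intro h <;> have := h.subset (a := false) (by simp) <;> simp at this

end Counting

end SimpleGame

/-! ### Evaluation of the count -/

theorem corollaryc (n : ℕ) :
    (n ≤ 5 → SimpleGame.numWeightedDual n 1 = 2 ^ n - 1) ∧
    (6 ≤ n → (SimpleGame.numWeightedDual n 1 : ℚ) =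
      ((n : ℚ) ^ 4 - 6 * (n : ℚ) ^ 3 + 23 * (n : ℚ) ^ 2 - 18 * (n : ℚ) + 12) / 12) := by
  rw [SimpleGame.numWeightedDual_one]
  cases n with
  | zero =>
    rw [SimpleGame.wordCount_zero (by simp [SimpleGame.IsNarrow])]
    simp
  | succ n =>
    have h := SimpleGame.wordCount_isNarrow n
    constructor
    · intro hn
      have hn' : n ≤ 4 := by omega
      -- Both patterns have length six, so no shorter word is excluded; accordingly the quartic
      -- count equals the power of two at lengths one to five.
      interval_cases n <;> omega
    · intro _
      have hpos : 1 ≤ SimpleGame.wordCount SimpleGame.IsNarrow (n + 1) := by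
        by_contra hc
        have h0 : SimpleGame.wordCount SimpleGame.IsNarrow (n + 1) = 0 := by omega
        rw [h0] at h
        have h' : (2 * (n : ℤ) ^ 3) = (n : ℤ) ^ 4 + 11 * (n : ℤ) ^ 2 + 14 * n + 24 := by
          have : ((12 * 0 + 2 * n ^ 3 : ℕ) : ℤ) = ((n ^ 4 + 11 * n ^ 2 + 14 * n + 24 : ℕ) : ℤ) := by
            rw [h]
          push_cast at this
          linarith
        -- The right side minus the left is `(n² - n)² + 10n² + 14n + 24`, which is positive.
        nlinarith [sq_nonneg ((n : ℤ) ^ 2 - n), sq_nonneg (n : ℤ)]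
      have h' : (12 : ℚ) * (SimpleGame.wordCount SimpleGame.IsNarrow (n + 1) : ℚ) + 2 * (n : ℚ) ^ 3
          = (n : ℚ) ^ 4 + 11 * (n : ℚ) ^ 2 + 14 * n + 24 := by exact_mod_cast h
      rw [Nat.cast_sub hpos]
      push_cast
      linarith
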